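/- Let $(\mathcal A,\|\cdot\|_{\mathcal A})$ be a real Banach space, let $\mathcal B=\mathcal A'$ be its topological dual with the dual norm $\|\cdot\|_{\mathcal B}$, and let $\mathcal H$ be a real Hilbert space. Let $L\ge 0$, $y\in\mathbb R^L$, $\varphi_1,\dots,\varphi_L\in\mathcal A$, $\phi_1,\dots,\phi_L\in\mathcal H$ and $\lambda_1,\lambda_2>0$. Define $\Phi_1:\mathcal B\to\mathbb R^L$ by $\Phi_1(s)=(s(\varphi_\ell))_{1\le \ell\le L}$ and $\Phi_2:\mathcal H\to\mathbb R^L$ by $\Phi_2(s)=(\langle \phi_\ell,s\rangle_{\mathcal H})_{1\le \ell\le L}$, with adjoint $\Phi_2^*$. Let $$\mathcal W(\lambda_1,\lambda_2)=\underset{(s_1,s_2)\in\mathcal B\times\mathcal H}{\arg\min}\ \tfrac12\|y-(\Phi_1(s_1)+\Phi_2(s_2))\|_2^2+\lambda_1\|s_1\|_{\mathcal B}+\tfrac{\lambda_2}{2}\|s_2\|_{\mathcal H}^2,$$ let $M=\frac1{\lambda_2}(\Phi_2\Phi_2^*+\lambda_2 I_L)$, which is a positive definite matrix, and let $$\mathcal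 V=\underset{s_1\in\mathcal B}{\arg\min}\ \tfrac12\|M^{-1/2}(y-\Phi_1(s_1))\|_2^2+\lambda_1\|s_1\|_{\mathcal B}.$$ Then $\mathcal V$ is non-empty and there is a vector $w\in\mathbb R^L$ such that $\Phi_1(s_1)=w$ for every $s_1\in\mathcal V$ (so $w$ is unique). With $$\hat s_2:=\tfrac1{\lambda_2}\,\Phi_2^*M^{-1}(y-w)$$ one has $\mathcal W(\lambda_1,\lambda_2)=\mathcal V\times\{\hat s_2\}$, and every extreme point of $\mathcal W(\lambda_1,\lambda_2)$ is of the form $$\Bigl(\sum_{1\le k\le K}\alpha_k e_k,\ \hat s_2\Bigr),$$ where $0\le K\le L$, the $\alpha_k$ are nonzero real numbers, and the $e_k$ are distinct extreme points of the unit ball $\{f\in\mathcal B:\|f\|_{\mathcal B}\le 1\}$. -/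

import Mathlib

open scoped MatrixOrder

noncomputable section

/-- The measurement operator `s ↦ (⟨φ₁, s⟩, …, ⟨φ_L, s⟩)` on the dual space `B = A'`, given by
functionals `φ_ℓ` in the predual `A`. -/
def banachMeasure {A : Type*} [NormedAddCommGroup A] [NormedSpace ℝ A] {L : ℕ}
    (φ : Fin L → A) (s : StrongDual ℝ A) : EuclideanSpace ℝ (Fin L) :=
  WithLp.toLp 2 (fun l => s (φ l))

/-- The measurement operator `s ↦ (⟪φ₁, s⟫, …, ⟪φ_L, s⟫)` on a Hilbert space `H`. -/
def hilbertMeasure {H : Type*} [NormedAddCommGroup H] [InnerProductSpace ℝ H] {L : ℕ}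
    (φ : Fin L → H) : H →L[ℝ] EuclideanSpace ℝ (Fin L) :=
  ((EuclideanSpace.equiv (Fin L) ℝ).symm : (Fin L → ℝ) →L[ℝ] EuclideanSpace ℝ (Fin L)) ∘L
    ContinuousLinearMap.pi (fun l => innerSL ℝ (φ l))

/-- The composite objective
`J(s₁, s₂) = ½‖y - (Φ₁ s₁ + Φ₂ s₂)‖² + lam₁ ‖s₁‖ + (lam₂ / 2) ‖s₂‖²`, where `‖s₁‖` is the dual
(operator) norm. -/
def compositeObjective {A H : Type*} [NormedAddCommGroup A] [NormedSpace ℝ A]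
    [NormedAddCommGroup H] [InnerProductSpace ℝ H] {L : ℕ}
    (y : EuclideanSpace ℝ (Fin L)) (φ₁ : Fin L → A) (φ₂ : Fin L → H) (lam₁ lam₂ : ℝ)
    (s : StrongDual ℝ A × H) : ℝ :=
  1 / 2 * ‖y - (banachMeasure φ₁ s.1 + hilbertMeasure φ₂ s.2)‖ ^ 2 + lam₁ * ‖s.1‖
    + lam₂ / 2 * ‖s.2‖ ^ 2

/-- The composite solution set `W(lam₁, lam₂)`: all minimizers of the composite objective. -/
def compositeSolutions {A H : Type*} [NormedAddCommGroup A] [NormedSpace ℝ A]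
    [NormedAddCommGroup H] [InnerProductSpace ℝ H] {L : ℕ}
    (y : EuclideanSpace ℝ (Fin L)) (φ₁ : Fin L → A) (φ₂ : Fin L → H) (lam₁ lam₂ : ℝ) :
    Set (StrongDual ℝ A × H) :=
  {s | IsMinOn (compositeObjective y φ₁ φ₂ lam₁ lam₂) Set.univ s}

/-- The matrix `M = (1 / lam₂) (G + lam₂ I)` where `G` is the Gram matrix of `φ₂`. -/
def couplingMatrix {H : Type*} [NormedAddCommGroup H] [InnerProductSpace ℝ H] {L : ℕ}
    (φ₂ : Fin L → H) (lam₂ : ℝ) : Matrix (Fin L) (Fin L) ℝ :=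
  (1 / lam₂) • (Matrix.gram ℝ φ₂ + lam₂ • (1 : Matrix (Fin L) (Fin L) ℝ))

/-- The decoupled objective `½‖M^{-1/2} (y - Φ₁ s)‖² + lam₁ ‖s‖` on `B = A'`; here `CFC.sqrt` is
the positive semidefinite square root of a positive semidefinite matrix. -/
def banachObjective {A H : Type*} [NormedAddCommGroup A] [NormedSpace ℝ A]
    [NormedAddCommGroup H] [InnerProductSpace ℝ H] {L : ℕ}
    (y : EuclideanSpace ℝ (Fin L)) (φ₁ : Fin L → A) (φ₂ : Fin L → H) (lam₁ lam₂ : ℝ)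
    (s : StrongDual ℝ A) : ℝ :=
  1 / 2 * ‖Matrix.toEuclideanLin (CFC.sqrt (couplingMatrix φ₂ lam₂))⁻¹
      (y - banachMeasure φ₁ s)‖ ^ 2 + lam₁ * ‖s‖

/-- The solution set `V(M, lam₁)`: all minimizers of the decoupled objective. -/
def banachSolutions {A H : Type*} [NormedAddCommGroup A] [NormedSpace ℝ A]
    [NormedAddCommGroup H] [InnerProductSpace ℝ H] {L : ℕ}
    (y : EuclideanSpace ℝ (Fin L)) (φ₁ : Fin L → A) (φ₂ : Fin L → H) (lam₁ lam₂ : ℝ) :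
    Set (StrongDual ℝ A) :=
  {s | IsMinOn (banachObjective y φ₁ φ₂ lam₁ lam₂) Set.univ s}

/-- The Hilbert component `(1 / lam₂) Φ₂* M⁻¹ (y - w)`. -/
def hilbertComponent {H : Type*} [NormedAddCommGroup H] [InnerProductSpace ℝ H]
    [CompleteSpace H] {L : ℕ} (y : EuclideanSpace ℝ (Fin L)) (φ₂ : Fin L → H) (lam₂ : ℝ)
    (w : EuclideanSpace ℝ (Fin L)) : H :=
  (1 / lam₂) • ContinuousLinearMap.adjoint (hilbertMeasure φ₂)
    (Matrix.toEuclideanLin (couplingMatrix φ₂ lam₂)⁻¹ (y - w))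

end

/-! Completing the square in `t` (`compositeObjective_eq`) splits the composite objective into the
decoupled one plus a nonnegative quadratic that vanishes only at the Hilbert component of `s`. Hence
`W` is the graph of that component over `V`. Strict convexity of the data term makes the measurement
constant on `V`, so the graph is a product with a singleton; existence comes from weak-* compactness
of balls. For the sparse form, let `s ≠ 0` be extreme in `V`. It is a least-norm solution of a
linear system with `L` equations. On the face of the unit ball containing `s / ‖s‖`, the measurement
is injective by extremality and misses `Φ s` by minimality, so that face has dimension less than
`L`. A Carathéodory argument on faces then needs at most `L` extreme points. -/

/-! ### Faces of convex sets and Carathéodory's theorem. -/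

section Faces

variable {E : Type*} [NormedAddCommGroup E] [NormedSpace ℝ E]

/-- The directions in which one can move both ways from `x` inside the convex set `C`; for `x ∈ C`
this is the direction of the smallest face of `C` that contains `x`. -/
def Convex.faceDirection {C : Set E} (hC : Convex ℝ C) {x : E} (hx : x ∈ C) : Submodule ℝ E where
  carrier := {d | ∃ ε > (0 : ℝ), x + ε • d ∈ C ∧ x - ε • d ∈ C}
  zero_mem' := ⟨1, one_pos, by simpa using hx, by simpa using hx⟩
  add_mem' := by
    rintro a b ⟨ε, hε, ha₁, ha₂⟩ ⟨δ, hδ, hb₁, hb₂⟩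
    have hsum : δ / (ε + δ) + ε / (ε + δ) = 1 := by field_simp; ring
    refine ⟨ε * δ / (ε + δ), by positivity, ?_, ?_⟩
    · convert hC ha₁ hb₁ (by positivity) (by positivity) hsum using 1
      match_scalars <;> field_simp
      ring
    · convert hC ha₂ hb₂ (by positivity) (by positivity) hsum using 1
      match_scalars <;> field_simp
      ring
  smul_mem' := by
    rintro c d ⟨ε, hε, h₁, h₂⟩
    rcases lt_trichotomy c 0 with hc | rfl | hc
    · have hc' : c ≠ 0 := hc.ne
      refine ⟨ε / (-c), div_pos hε (neg_pos.2 hc), ?_, ?_⟩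
      · convert h₂ using 1
        match_scalars <;> field_simp
      · convert h₁ using 1
        match_scalars <;> field_simp
    · exact ⟨1, one_pos, by simpa using hx, by simpa using hx⟩
    · refine ⟨ε / c, div_pos hε hc, ?_, ?_⟩
      · convert h₁ using 1
        match_scalars <;> field_simp
      · convert h₂ using 1
        match_scalars <;> field_simp

/-- The homothety of center `q` and ratio `a` maps `C` into itself and a segment around `p` to one
around `x`. -/
theorem Convex.faceDirection_mono {C : Set E} (hC : Convex ℝ C) {x p q : E} (hx : x ∈ C)
    (hp : p ∈ C) (hq : q ∈ C) {a b : ℝ} (ha : 0 < a) (hb : 0 ≤ b) (hab : a + b = 1)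
    (h : a • p + b • q = x) : hC.faceDirection hp ≤ hC.faceDirection hx := by
  rintro d ⟨ε, hε, h₁, h₂⟩
  refine ⟨a * ε, by positivity, ?_, ?_⟩
  · convert hC h₁ hq ha.le hb hab using 1
    rw [← h]; module
  · convert hC h₂ hq ha.le hb hab using 1
    rw [← h]; module

theorem Convex.sub_mem_faceDirection {C : Set E} (hC : Convex ℝ C) {x p q : E} (hx : x ∈ C)
    (hp : p ∈ C) (hq : q ∈ C) {a b : ℝ} (ha : 0 < a) (hb : 0 < b) (hab : a + b = 1)
    (h : a • p + b • q = x) : p - q ∈ hC.faceDirection hx := by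
  have key : ∀ t : ℝ, 0 ≤ a + t → 0 ≤ b - t → x + t • (p - q) ∈ C := fun t h₁ h₂ => by
    convert hC hp hq h₁ h₂ (by linarith) using 1
    rw [← h]; module
  have hm := min_le_left a b
  have hm' := min_le_right a b
  have hm₀ := lt_min ha hb
  refine ⟨min a b, hm₀, key _ (by linarith) (by linarith), ?_⟩
  rw [sub_eq_add_neg, ← neg_smul]
  exact key _ (by linarith) (by linarith)

theorem Convex.exists_sub_mem_faceDirection {C : Set E} (hC : Convex ℝ C) {p : E} (hp : p ∈ C)
    {s : Finset E} (hs : ∀ y ∈ s, y ∈ C) (hps : p ∈ convexHull ℝ (s : Set E)) :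
    ∃ e ∈ s, p - e ∈ hC.faceDirection hp := by
  classical
  obtain ⟨w, hw₀, hw₁, hwp⟩ := Finset.mem_convexHull'.1 hps
  obtain ⟨e, hes, hwe⟩ : ∃ e ∈ s, 0 < w e := by
    by_contra! hcon
    linarith [Finset.sum_nonpos hcon]
  have hwe₁ : w e ≤ 1 := hw₁ ▸ Finset.single_le_sum hw₀ hes
  -- Moving away from `e` by `w e` leaves every weight nonnegative: that of `e` becomes `(w e) ^ 2`.
  refine ⟨e, hes, w e, hwe, ?_, ?_⟩
  · have hsum : ∑ y ∈ s, ((1 + w e) * w y - if y = e then w e else 0) = 1 := by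
      rw [Finset.sum_sub_distrib, ← Finset.mul_sum, hw₁, Finset.sum_ite_eq' s e, if_pos hes]
      ring
    have hmem := hC.sum_mem (t := s) (z := id) (fun y hy => ?_) hsum hs
    · convert hmem using 1
      simp only [id, sub_smul, mul_smul, ite_smul, zero_smul]
      rw [Finset.sum_sub_distrib, ← Finset.smul_sum, hwp, Finset.sum_ite_eq' s e, if_pos hes]
      module
    · have hy₀ := hw₀ y hy
      split_ifs with hye
      · subst hye; nlinarith
      · nlinarith
  · convert hC hp (hs e hes) (sub_nonneg.2 hwe₁) hwe.le (by ring) using 1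
    module

theorem Convex.mem_extremePoints_of_faceDirection_eq_bot {C : Set E} (hC : Convex ℝ C) {x : E}
    (hx : x ∈ C) (h : hC.faceDirection hx = ⊥) : x ∈ C.extremePoints ℝ := by
  refine ⟨hx, ?_⟩
  rintro p hp q hq ⟨a, b, ha, hb, hab, rfl⟩
  have hpq := hC.sub_mem_faceDirection hx hp hq ha hb hab rfl
  rw [h, Submodule.mem_bot, sub_eq_zero] at hpq
  subst hpq
  rw [← add_smul, hab, one_smul]

/-- Moving from `x` along a nonzero face direction until leaving `C` strictly decreases the face
direction. -/
theorem Convex.exists_faceDirection_lt {C : Set E} (hC : Convex ℝ C) (hcl : IsClosed C)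
    (hbd : Bornology.IsBounded C) {x d : E} (hx : x ∈ C) (hd : d ∈ hC.faceDirection hx)
    (hd₀ : d ≠ 0) :
    ∃ t > (0 : ℝ), ∃ hp : x + t • d ∈ C, hC.faceDirection hp < hC.faceDirection hx := by
  obtain ⟨ε, hε, h₁, h₂⟩ := hd
  obtain ⟨R, hR⟩ := hbd.exists_norm_le
  have hdn : 0 < ‖d‖ := norm_pos_iff.2 hd₀
  set T : Set ℝ := {t | x + t • d ∈ C} with hT
  have hTcl : IsClosed T := hcl.preimage (by fun_prop)
  have hTbd : BddAbove T := by
    refine ⟨(R + ‖x‖) / ‖d‖, fun t ht => ?_⟩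
    rw [le_div_iff₀ hdn]
    calc t * ‖d‖ ≤ ‖t • d‖ := by
          rw [norm_smul]; exact mul_le_mul_of_nonneg_right (le_abs_self t) hdn.le
      _ = ‖(x + t • d) - x‖ := by congr 1; abel
      _ ≤ ‖x + t • d‖ + ‖x‖ := norm_sub_le _ _
      _ ≤ R + ‖x‖ := by gcongr; exact hR _ ht
  have hmem : sSup T ∈ T := hTcl.csSup_mem ⟨ε, h₁⟩ hTbd
  have hpos : 0 < sSup T := hε.trans_le (le_csSup hTbd h₁)
  refine ⟨sSup T, hpos, hmem, lt_of_le_of_ne ?_ fun heq => ?_⟩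
  · refine hC.faceDirection_mono hx hmem h₂ (a := ε / (sSup T + ε)) (b := sSup T / (sSup T + ε))
      (by positivity) (by positivity) (by field_simp; ring) ?_
    match_scalars <;> field_simp <;> ring
  · have : d ∈ hC.faceDirection hmem := by
      rw [heq]; exact ⟨ε, hε, h₁, h₂⟩
    obtain ⟨δ, hδ, h₃, -⟩ := this
    have : sSup T + δ ∈ T := by
      simp only [hT, Set.mem_ofPred_eq]
      convert h₃ using 1
      module
    linarith [le_csSup hTbd this]

/-- A point of a closed bounded convex set whose face has finite dimension `n` is a convex
combination of at most `n + 1` extreme points. -/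
theorem Convex.exists_finset_extremePoints {C : Set E} (hC : Convex ℝ C) (hcl : IsClosed C)
    (hbd : Bornology.IsBounded C) (n : ℕ) {x : E} (hx : x ∈ C)
    [FiniteDimensional ℝ (hC.faceDirection hx)]
    (hn : Module.finrank ℝ (hC.faceDirection hx) ≤ n) :
    ∃ t : Finset E, t.card ≤ n + 1 ∧ (t : Set E) ⊆ C.extremePoints ℝ ∧
      x ∈ convexHull ℝ (t : Set E) := by
  induction n generalizing x with
  | zero =>
    have hbot : hC.faceDirection hx = ⊥ := Submodule.finrank_eq_zero.1 (Nat.le_zero.1 hn)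
    exact ⟨{x}, by simp, by simpa using hC.mem_extremePoints_of_faceDirection_eq_bot hx hbot,
      by simp⟩
  | succ n ih =>
    by_cases hbot : hC.faceDirection hx = ⊥
    · exact ⟨{x}, by simp, by simpa using hC.mem_extremePoints_of_faceDirection_eq_bot hx hbot,
        by simp⟩
    have descend : ∀ d ∈ hC.faceDirection hx, d ≠ 0 → ∃ t > (0 : ℝ), x + t • d ∈ C ∧
        ∃ s : Finset E, s.card ≤ n + 1 ∧ (s : Set E) ⊆ C.extremePoints ℝ ∧
          x + t • d ∈ convexHull ℝ (s : Set E) := by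
      intro d hd hd₀
      obtain ⟨t, ht, hp, hlt⟩ := hC.exists_faceDirection_lt hcl hbd hx hd hd₀
      have := Submodule.finrank_lt_finrank_of_lt hlt
      have : FiniteDimensional ℝ (hC.faceDirection hp) :=
        Submodule.finiteDimensional_of_le hlt.le
      exact ⟨t, ht, hp, ih hp (by omega)⟩
    obtain ⟨d, hd, hd₀⟩ := Submodule.exists_mem_ne_zero_of_ne_bot hbot
    obtain ⟨t, ht, hp, s, -, hs, hps⟩ := descend d hd hd₀
    -- The first descent serves only to find an extreme point `e` of the face of `x`.
    obtain ⟨e, he, hed⟩ : ∃ e ∈ C.extremePoints ℝ, x - e ∈ hC.faceDirection hx := by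
      obtain ⟨e, hes, hpe⟩ := hC.exists_sub_mem_faceDirection hp (fun y hy => (hs hy).1) hps
      refine ⟨e, hs hes, ?_⟩
      have hd' := hd
      obtain ⟨ε, hε, -, h₂⟩ := hd'
      have hle := hC.faceDirection_mono hx hp h₂ (a := ε / (t + ε)) (b := t / (t + ε))
        (by positivity) (by positivity) (by field_simp; ring)
        (by match_scalars <;> field_simp <;> ring)
      have : x - e = (x + t • d - e) - t • d := by abel
      rw [this]
      exact Submodule.sub_mem _ (hle hpe) (Submodule.smul_mem _ _ hd)
    by_cases hxe : x - e = 0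
    · rw [sub_eq_zero] at hxe
      exact ⟨{e}, by simp, by simpa using he, by simp [hxe]⟩
    -- The ray from `e` through `x` exits at a point with a smaller face, and `x` lies between the
    -- two. Each dimension thus costs one extra point.
    obtain ⟨t, ht, hp, s, hcard, hs, hps⟩ := descend (x - e) hed hxe
    classical
    refine ⟨insert e s, (Finset.card_insert_le _ _).trans (by omega), ?_, ?_⟩
    · rw [Finset.coe_insert, Set.insert_subset_iff]
      exact ⟨he, hs⟩
    · have h₁ : x + t • (x - e) ∈ convexHull ℝ ((insert e s : Finset E) : Set E) :=
        convexHull_mono (by simp) hps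
      have h₂ : e ∈ convexHull ℝ ((insert e s : Finset E) : Set E) :=
        subset_convexHull ℝ _ (by simp)
      convert convex_convexHull ℝ _ h₁ h₂ (a := 1 / (1 + t)) (b := t / (1 + t))
        (by positivity) (by positivity) (by field_simp) using 1
      match_scalars <;> field_simp
      ring

end Faces

/-! ### Measurement operators and the Gram matrix. -/

section Measurements

variable {A H : Type*} [NormedAddCommGroup A] [NormedSpace ℝ A]
  [NormedAddCommGroup H] [InnerProductSpace ℝ H] {L : ℕ}

theorem banachMeasure_add (φ : Fin L → A) (s t : StrongDual ℝ A) :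
    banachMeasure φ (s + t) = banachMeasure φ s + banachMeasure φ t := by
  ext l; simp [banachMeasure]

theorem banachMeasure_smul (φ : Fin L → A) (c : ℝ) (s : StrongDual ℝ A) :
    banachMeasure φ (c • s) = c • banachMeasure φ s := by
  ext l; simp [banachMeasure]

/-- `banachMeasure` as a linear map. -/
def banachMeasureLin (φ : Fin L → A) : StrongDual ℝ A →ₗ[ℝ] EuclideanSpace ℝ (Fin L) where
  toFun := banachMeasure φ
  map_add' := banachMeasure_add φ
  map_smul' := banachMeasure_smul φ

@[simp]
theorem hilbertMeasure_apply (φ : Fin L → H) (s : H) (l : Fin L) :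
    hilbertMeasure φ s l = inner ℝ (φ l) s :=
  rfl

theorem adjoint_hilbertMeasure [CompleteSpace H] (φ : Fin L → H)
    (v : EuclideanSpace ℝ (Fin L)) :
    ContinuousLinearMap.adjoint (hilbertMeasure φ) v = ∑ l, v l • φ l := by
  refine ext_inner_right ℝ fun h => ?_
  rw [ContinuousLinearMap.adjoint_inner_left, sum_inner, PiLp.inner_apply]
  simp [real_inner_smul_left, mul_comm]

theorem hilbertMeasure_adjoint [CompleteSpace H] (φ : Fin L → H)
    (v : EuclideanSpace ℝ (Fin L)) :
    hilbertMeasure φ (ContinuousLinearMap.adjoint (hilbertMeasure φ) v) =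
      Matrix.toEuclideanLin (Matrix.gram ℝ φ) v := by
  ext l
  rw [adjoint_hilbertMeasure, hilbertMeasure_apply, inner_sum,
    Matrix.toLpLin_apply]
  simp [Matrix.mulVec, dotProduct, real_inner_smul_right, Matrix.gram_apply, mul_comm]

end Measurements

/-! ### Inverse square roots of positive definite matrices. -/

section Matrices

variable {n : Type*} [Fintype n] [DecidableEq n]

theorem Matrix.toEuclideanLin_mul_apply (S T : Matrix n n ℝ) (v : EuclideanSpace ℝ n) :
    Matrix.toEuclideanLin (S * T) v = Matrix.toEuclideanLin S (Matrix.toEuclideanLin T v) := by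
  ext l
  simp [Matrix.mulVec_mulVec]

theorem Matrix.toEuclideanLin_one_apply (v : EuclideanSpace ℝ n) :
    Matrix.toEuclideanLin (1 : Matrix n n ℝ) v = v := by
  ext l
  simp

theorem Matrix.PosDef.isUnit_det_sqrt {M : Matrix n n ℝ} (hM : M.PosDef) :
    IsUnit (CFC.sqrt M).det := by
  have h : CFC.sqrt M * CFC.sqrt M = M := CFC.sqrt_mul_sqrt_self M hM.posSemidef.nonneg
  have hdet : IsUnit M.det := (Matrix.isUnit_iff_isUnit_det M).1 hM.isUnit
  rw [← h, Matrix.det_mul] at hdet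
  exact isUnit_of_mul_isUnit_left hdet

theorem Matrix.PosDef.toEuclideanLin_inv_sqrt_injective {M : Matrix n n ℝ} (hM : M.PosDef) :
    Function.Injective (Matrix.toEuclideanLin (CFC.sqrt M)⁻¹) := by
  intro u v huv
  have h := congrArg (Matrix.toEuclideanLin (CFC.sqrt M)) huv
  simpa only [← Matrix.toEuclideanLin_mul_apply, Matrix.mul_nonsing_inv _ hM.isUnit_det_sqrt,
    Matrix.toEuclideanLin_one_apply] using h

theorem Matrix.PosDef.norm_sq_inv_sqrt {M : Matrix n n ℝ} (hM : M.PosDef)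
    (r : EuclideanSpace ℝ n) :
    ‖Matrix.toEuclideanLin (CFC.sqrt M)⁻¹ r‖ ^ 2 = inner ℝ (Matrix.toEuclideanLin M⁻¹ r) r := by
  have h : CFC.sqrt M * CFC.sqrt M = M := CFC.sqrt_mul_sqrt_self M hM.posSemidef.nonneg
  have hinv : M⁻¹ = (CFC.sqrt M)⁻¹ * (CFC.sqrt M)⁻¹ := by
    rw [← Matrix.mul_inv_rev, h]
  have hherm : ((CFC.sqrt M)⁻¹).IsHermitian :=
    (Matrix.nonneg_iff_posSemidef.1 (CFC.sqrt_nonneg M)).1.inv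
  rw [hinv, Matrix.toEuclideanLin_mul_apply, ← real_inner_self_eq_norm_sq]
  exact (Matrix.isSymmetric_toEuclideanLin_iff.2 hherm _ _).symm

end Matrices

/-! ### Elimination of the Hilbert variable. -/

section Decoupling

variable {A H : Type*} [NormedAddCommGroup A] [NormedSpace ℝ A]
  [NormedAddCommGroup H] [InnerProductSpace ℝ H] {L : ℕ}

theorem couplingMatrix_posDef (φ₂ : Fin L → H) {lam₂ : ℝ} (hlam₂ : 0 < lam₂) :
    (couplingMatrix φ₂ lam₂).PosDef := by
  have h : (lam₂ • (1 : Matrix (Fin L) (Fin L) ℝ)).PosDef := Matrix.PosDef.one.smul hlam₂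
  exact (Matrix.PosDef.posSemidef_add (Matrix.posSemidef_gram ℝ φ₂) h).smul
    (one_div_pos.2 hlam₂)

/-- Completing the square in the Hilbert variable. -/
theorem compositeObjective_eq [CompleteSpace H] (y : EuclideanSpace ℝ (Fin L)) (φ₁ : Fin L → A)
    (φ₂ : Fin L → H) (lam₁ : ℝ) {lam₂ : ℝ} (hlam₂ : 0 < lam₂) (s : StrongDual ℝ A) (t : H) :
    compositeObjective y φ₁ φ₂ lam₁ lam₂ (s, t) =
      banachObjective y φ₁ φ₂ lam₁ lam₂ s +
        (1 / 2 * ‖hilbertMeasure φ₂ (t - hilbertComponent y φ₂ lam₂ (banachMeasure φ₁ s))‖ ^ 2 +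
          lam₂ / 2 * ‖t - hilbertComponent y φ₂ lam₂ (banachMeasure φ₁ s)‖ ^ 2) := by
  have hM := couplingMatrix_posDef φ₂ hlam₂
  have hdet : IsUnit (couplingMatrix φ₂ lam₂).det :=
    (Matrix.isUnit_iff_isUnit_det _).1 hM.isUnit
  unfold compositeObjective banachObjective
  rw [hM.norm_sq_inv_sqrt]
  set r := y - banachMeasure φ₁ s with hr
  set u := Matrix.toEuclideanLin (couplingMatrix φ₂ lam₂)⁻¹ r with hu
  have hcomp : hilbertComponent y φ₂ lam₂ (banachMeasure φ₁ s) =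
      (1 / lam₂) • ContinuousLinearMap.adjoint (hilbertMeasure φ₂) u := rfl
  set d := t - hilbertComponent y φ₂ lam₂ (banachMeasure φ₁ s) with hd
  set a := ContinuousLinearMap.adjoint (hilbertMeasure φ₂) u with ha
  -- This is `M u = r`: at `d = 0` the residual is exactly `u`. The cross terms in `d` then cancel,
  -- and the rest is half of `⟪u, r⟫`.
  have hMu : (1 / lam₂) • hilbertMeasure φ₂ a + u = r := by
    have h₁ : Matrix.toEuclideanLin (couplingMatrix φ₂ lam₂) u = r := by
      rw [hu, ← Matrix.toEuclideanLin_mul_apply, Matrix.mul_nonsing_inv _ hdet,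
        Matrix.toEuclideanLin_one_apply]
    rw [← h₁, ha, hilbertMeasure_adjoint, couplingMatrix, map_smul, map_add, map_smul,
      LinearMap.smul_apply, LinearMap.add_apply, LinearMap.smul_apply,
      Matrix.toEuclideanLin_one_apply]
    match_scalars <;> field_simp
  have ht : t = (1 / lam₂) • a + d := by rw [hd, hcomp]; abel
  have hres : y - (banachMeasure φ₁ s + hilbertMeasure φ₂ t) = u - hilbertMeasure φ₂ d := by
    rw [← sub_sub, ← hr, ht, map_add, map_smul, ← hMu]; abel
  have hau : inner ℝ a a = inner ℝ u (hilbertMeasure φ₂ a) := by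
    rw [ha, ContinuousLinearMap.adjoint_inner_left]
  have had : inner ℝ a d = inner ℝ u (hilbertMeasure φ₂ d) := by
    rw [ha, ContinuousLinearMap.adjoint_inner_left]
  simp only
  rw [hres, norm_sub_sq_real, ht, norm_add_sq_real, norm_smul, real_inner_smul_left, had, mul_pow,
    ← real_inner_self_eq_norm_sq a, hau, ← hMu, inner_add_right, real_inner_smul_right,
    real_inner_self_eq_norm_sq, Real.norm_eq_abs, sq_abs]
  field_simp
  ring

end Decoupling

/-! ### Sparse least-norm solutions. -/

section Sparse

variable {E F : Type*} [NormedAddCommGroup E] [NormedSpace ℝ E] [AddCommGroup F] [Module ℝ F]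
  [FiniteDimensional ℝ F]

/-- A solution of least norm of a linear system in a space of finite dimension `n` which is an
extreme point of the set of such solutions is a combination of at most `n` extreme points of the
unit ball. -/
theorem exists_sum_smul_extremePoints_of_minimal_norm (Φ : E →ₗ[ℝ] F) {s : E}
    (hmin : ∀ f, Φ f = Φ s → ‖s‖ ≤ ‖f‖)
    (hext : s ∈ Set.extremePoints ℝ {f : E | Φ f = Φ s ∧ ‖f‖ ≤ ‖s‖}) :
    ∃ (K : ℕ) (α : Fin K → ℝ) (e : Fin K → E),
      K ≤ Module.finrank ℝ F ∧ (∀ k, α k ≠ 0) ∧ Function.Injective e ∧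
      (∀ k, e k ∈ Set.extremePoints ℝ {f : E | ‖f‖ ≤ 1}) ∧ s = ∑ k, α k • e k := by
  classical
  rcases eq_or_ne s 0 with rfl | hs₀
  · exact ⟨0, Fin.elim0, Fin.elim0, Nat.zero_le _, fun k => k.elim0, fun k => k.elim0,
      fun k => k.elim0, by simp⟩
  have hc : 0 < ‖s‖ := norm_pos_iff.2 hs₀
  have hball : {f : E | ‖f‖ ≤ 1} = Metric.closedBall 0 1 := by ext; simp
  have hC : Convex ℝ {f : E | ‖f‖ ≤ 1} := hball ▸ convex_closedBall 0 1
  have hcl : IsClosed {f : E | ‖f‖ ≤ 1} := hball ▸ Metric.isClosed_closedBall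
  have hbd : Bornology.IsBounded {f : E | ‖f‖ ≤ 1} := hball ▸ Metric.isBounded_closedBall
  have hx : ‖s‖⁻¹ • s ∈ {f : E | ‖f‖ ≤ 1} := by
    simp [norm_smul, hc.ne']
  have hdir : ∀ d ∈ hC.faceDirection hx, ∃ ε > (0 : ℝ), ‖s + ε • d‖ ≤ ‖s‖ ∧ ‖s - ε • d‖ ≤ ‖s‖ := by
    rintro d ⟨ε, hε, h₁, h₂⟩
    have hscale : ∀ v : E, ‖‖s‖⁻¹ • s + v‖ ≤ 1 → ‖s + ‖s‖ • v‖ ≤ ‖s‖ := fun v hv => by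
      have : s + ‖s‖ • v = ‖s‖ • (‖s‖⁻¹ • s + v) := by
        rw [smul_add, smul_inv_smul₀ hc.ne']
      rw [this, norm_smul, norm_norm]
      exact mul_le_of_le_one_right hc.le hv
    refine ⟨‖s‖ * ε, by positivity, ?_, ?_⟩
    · simpa [mul_smul] using hscale (ε • d) h₁
    · simpa [mul_smul, ← sub_eq_add_neg] using
        hscale (-(ε • d)) (by simpa [← sub_eq_add_neg] using h₂)
  set Ψ : hC.faceDirection hx →ₗ[ℝ] F := Φ.domRestrict (hC.faceDirection hx) with hΨ
  -- Along a face direction in the kernel of `Φ`, `s` could move both ways among the solutions,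
  -- against extremality.
  have hinj : Function.Injective Ψ := by
    rw [← LinearMap.ker_eq_bot, LinearMap.ker_eq_bot']
    rintro ⟨d, hd⟩ hd₀
    have hΦd : Φ d = 0 := hd₀
    obtain ⟨ε, hε, h₁, h₂⟩ := hdir d hd
    have := hext.2 (x₁ := s + ε • d) ⟨by simp [hΦd], h₁⟩ (x₂ := s - ε • d)
      ⟨by simp [hΦd], h₂⟩ ⟨1 / 2, 1 / 2, by norm_num, by norm_num, by norm_num, by module⟩
    have hd0 : d = 0 := by simpa [hε.ne'] using this
    simp [hd0]
  -- If `Φ d = Φ s`, rescaling `s + ε • d` by `(1 + ε)⁻¹` gives a solution of smaller norm. This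
  -- saves the dimension that offsets the `+ 1` of Carathéodory.
  have hne : LinearMap.range Ψ ≠ ⊤ := by
    intro htop
    obtain ⟨⟨d, hd⟩, hds⟩ : Φ s ∈ LinearMap.range Ψ := htop ▸ Submodule.mem_top
    have hΦd : Φ d = Φ s := hds
    obtain ⟨ε, hε, h₁, -⟩ := hdir d hd
    have h := hmin ((1 + ε)⁻¹ • (s + ε • d)) (by
      rw [map_smul, map_add, map_smul, hΦd]
      match_scalars
      field_simp)
    rw [norm_smul, Real.norm_of_nonneg (by positivity), inv_mul_eq_div,
      le_div_iff₀ (by positivity)] at h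
    nlinarith
  have : FiniteDimensional ℝ (hC.faceDirection hx) := FiniteDimensional.of_injective Ψ hinj
  have hrank : Module.finrank ℝ (hC.faceDirection hx) + 1 ≤ Module.finrank ℝ F := by
    rw [← LinearMap.finrank_range_of_inj hinj]
    exact Submodule.finrank_lt hne
  obtain ⟨t, hcard, htE, hts⟩ := hC.exists_finset_extremePoints hcl hbd _ hx le_rfl
  obtain ⟨w, -, -, hws⟩ := Finset.mem_convexHull'.1 hts
  set u := t.filter fun v => w v ≠ 0 with hu
  refine ⟨u.card, fun k => ‖s‖ * w (u.equivFin.symm k), fun k => u.equivFin.symm k,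
    ((Finset.card_filter_le _ _).trans hcard).trans hrank, fun k => ?_,
    Subtype.val_injective.comp u.equivFin.symm.injective, fun k => ?_, ?_⟩
  · exact mul_ne_zero hc.ne' (Finset.mem_filter.1 (u.equivFin.symm k).2).2
  · exact htE (Finset.mem_filter.1 (u.equivFin.symm k).2).1
  · rw [Equiv.sum_comp u.equivFin.symm (fun v : u => (‖s‖ * w v) • (v : E)),
      Finset.sum_coe_sort u (fun v => (‖s‖ * w v) • v)]
    simp only [mul_smul]
    rw [← Finset.smul_sum, hu, Finset.sum_filter_of_ne, hws, smul_inv_smul₀ hc.ne']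
    intro v _ hv hw
    exact hv (by simp [hw])

end Sparse

/-! ### Existence and structure of the solution sets. -/

section Solutions

variable {A H : Type*} [NormedAddCommGroup A] [NormedSpace ℝ A]
  [NormedAddCommGroup H] [InnerProductSpace ℝ H] {L : ℕ}
  {y : EuclideanSpace ℝ (Fin L)} {φ₁ : Fin L → A} {φ₂ : Fin L → H} {lam₁ lam₂ : ℝ}

theorem mem_banachSolutions {s : StrongDual ℝ A} :
    s ∈ banachSolutions y φ₁ φ₂ lam₁ lam₂ ↔
      ∀ f, banachObjective y φ₁ φ₂ lam₁ lam₂ s ≤ banachObjective y φ₁ φ₂ lam₁ lam₂ f := by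
  simp [banachSolutions, isMinOn_iff]

theorem WeakDual.lowerSemicontinuous_norm_toStrongDual :
    LowerSemicontinuous fun s : WeakDual ℝ A => ‖WeakDual.toStrongDual s‖ := by
  refine lowerSemicontinuous_iff_isClosed_preimage.2 fun r => ?_
  convert WeakDual.isClosed_closedBall (0 : StrongDual ℝ A) r using 1
  ext s
  simp

theorem continuous_banachMeasure_toStrongDual (φ : Fin L → A) :
    Continuous fun s : WeakDual ℝ A => banachMeasure φ (WeakDual.toStrongDual s) :=
  (PiLp.continuous_toLp 2 _).comp (continuous_pi fun l => WeakDual.eval_continuous (φ l))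

/-- Direct method: the objective is weak-* lower semicontinuous because the `φ₁ l` lie in the
predual, and it exceeds `J 0` outside the ball of radius `J 0 / lam₁`, which is weak-* compact. -/
theorem banachSolutions_nonempty (y : EuclideanSpace ℝ (Fin L)) (φ₁ : Fin L → A)
    (φ₂ : Fin L → H) (hlam₁ : 0 < lam₁) (lam₂ : ℝ) :
    (banachSolutions y φ₁ φ₂ lam₁ lam₂).Nonempty := by
  set J := banachObjective y φ₁ φ₂ lam₁ lam₂ with hJ
  have hle : ∀ s, lam₁ * ‖s‖ ≤ J s := fun s => by
    simp only [hJ, banachObjective, le_add_iff_nonneg_left]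
    positivity
  have hlsc : LowerSemicontinuous fun s : WeakDual ℝ A => J (WeakDual.toStrongDual s) := by
    refine LowerSemicontinuous.add (Continuous.lowerSemicontinuous ?_) ?_
    · have h := continuous_banachMeasure_toStrongDual φ₁
      have hT := (Matrix.toEuclideanLin (CFC.sqrt (couplingMatrix φ₂ lam₂))⁻¹
        ).continuous_of_finiteDimensional
      exact continuous_const.mul ((hT.comp (continuous_const.sub h)).norm.pow 2)
    · exact (continuous_const_mul lam₁).comp_lowerSemicontinuous
        WeakDual.lowerSemicontinuous_norm_toStrongDual
        (monotone_mul_left_of_nonneg hlam₁.le)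
  have hR : 0 ≤ J 0 / lam₁ := div_nonneg (by simpa using hle 0) hlam₁.le
  obtain ⟨s, -, hs⟩ := LowerSemicontinuousOn.exists_isMinOn
    (s := WeakDual.toStrongDual ⁻¹' Metric.closedBall (0 : StrongDual ℝ A) (J 0 / lam₁))
    ⟨0, by simpa using hR⟩ (WeakDual.isCompact_closedBall _ _) (hlsc.lowerSemicontinuousOn _)
  rw [isMinOn_iff] at hs
  refine ⟨WeakDual.toStrongDual s, mem_banachSolutions.2 fun f => ?_⟩
  by_cases hf : ‖f‖ ≤ J 0 / lam₁
  · exact hs (StrongDual.toWeakDual f) (by simpa using hf)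
  · have h₀ := hs 0 (by simpa using hR)
    rw [not_le, div_lt_iff₀ hlam₁, mul_comm] at hf
    exact h₀.trans (hf.le.trans (hle f))

/-- By the parallelogram law, two minimizers with different whitened residuals would have a strictly
better midpoint. -/
theorem banachMeasure_eq_of_mem_banachSolutions (hlam₁ : 0 < lam₁) (hlam₂ : 0 < lam₂)
    {s t : StrongDual ℝ A} (hs : s ∈ banachSolutions y φ₁ φ₂ lam₁ lam₂)
    (ht : t ∈ banachSolutions y φ₁ φ₂ lam₁ lam₂) : banachMeasure φ₁ s = banachMeasure φ₁ t := by
  have h₁ := mem_banachSolutions.1 hs ((1 / 2 : ℝ) • (s + t))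
  have h₂ := mem_banachSolutions.1 ht ((1 / 2 : ℝ) • (s + t))
  unfold banachObjective at h₁ h₂
  set T := Matrix.toEuclideanLin (CFC.sqrt (couplingMatrix φ₂ lam₂))⁻¹ with hT
  set a := T (y - banachMeasure φ₁ s) with ha
  set b := T (y - banachMeasure φ₁ t) with hb
  have hmid : T (y - banachMeasure φ₁ ((1 / 2 : ℝ) • (s + t))) = (1 / 2 : ℝ) • (a + b) := by
    rw [ha, hb, ← map_add, ← map_smul, banachMeasure_smul, banachMeasure_add]
    congr 1
    module
  have hnorm : ‖(1 / 2 : ℝ) • (s + t)‖ ≤ 1 / 2 * (‖s‖ + ‖t‖) := by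
    rw [norm_smul, Real.norm_of_nonneg (by norm_num)]
    gcongr
    exact norm_add_le s t
  have hlam := mul_le_mul_of_nonneg_left hnorm hlam₁.le
  have hpar := parallelogram_law_with_norm ℝ a b
  rw [hmid, norm_smul, Real.norm_of_nonneg (by norm_num), mul_pow] at h₁ h₂
  have hab : ‖a - b‖ = 0 := by
    have : ‖a - b‖ ^ 2 ≤ 0 := by nlinarith
    exact pow_eq_zero_iff two_ne_zero |>.1 (this.antisymm (sq_nonneg _))
  have := (couplingMatrix_posDef φ₂ hlam₂).toEuclideanLin_inv_sqrt_injective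
    (sub_eq_zero.1 (norm_eq_zero.1 hab))
  exact sub_right_injective this

theorem compositeSolutions_eq [CompleteSpace H] (hlam₂ : 0 < lam₂)
    {w : EuclideanSpace ℝ (Fin L)}
    (hw : ∀ s ∈ banachSolutions y φ₁ φ₂ lam₁ lam₂, banachMeasure φ₁ s = w) :
    compositeSolutions y φ₁ φ₂ lam₁ lam₂ =
      banachSolutions y φ₁ φ₂ lam₁ lam₂ ×ˢ {hilbertComponent y φ₂ lam₂ w} := by
  ext ⟨s, t⟩
  simp only [compositeSolutions, Set.mem_ofPred_eq, isMinOn_iff, Set.mem_univ, true_imp_iff,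
    Set.mem_prod, Set.mem_singleton_iff, Prod.forall, compositeObjective_eq _ _ _ _ hlam₂]
  constructor
  · intro h
    have ht : t = hilbertComponent y φ₂ lam₂ (banachMeasure φ₁ s) := by
      have h' := h s (hilbertComponent y φ₂ lam₂ (banachMeasure φ₁ s))
      simp only [sub_self, map_zero, norm_zero] at h'
      set d := t - hilbertComponent y φ₂ lam₂ (banachMeasure φ₁ s) with hd
      have hd₀ : lam₂ / 2 * ‖d‖ ^ 2 ≤ 0 := by nlinarith [sq_nonneg ‖hilbertMeasure φ₂ d‖]
      have hd₁ : ‖d‖ ^ 2 ≤ 0 := nonpos_of_mul_nonpos_right hd₀ (half_pos hlam₂)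
      exact sub_eq_zero.1 (norm_eq_zero.1
        (pow_eq_zero_iff two_ne_zero |>.1 (hd₁.antisymm (sq_nonneg _))))
    have hs : s ∈ banachSolutions y φ₁ φ₂ lam₁ lam₂ := mem_banachSolutions.2 fun f => by
      have h' := h f (hilbertComponent y φ₂ lam₂ (banachMeasure φ₁ f))
      rw [ht] at h'
      simpa using h'
    exact ⟨hs, by rw [ht, hw s hs]⟩
  · rintro ⟨hs, rfl⟩ f g
    rw [hw s hs, sub_self, map_zero, norm_zero, norm_zero]
    have := mem_banachSolutions.1 hs f
    have : 0 ≤ lam₂ / 2 * ‖g - hilbertComponent y φ₂ lam₂ (banachMeasure φ₁ f)‖ ^ 2 := by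
      positivity
    nlinarith [sq_nonneg ‖hilbertMeasure φ₂ (g - hilbertComponent y φ₂ lam₂ (banachMeasure φ₁ f))‖]

theorem norm_le_of_mem_banachSolutions (hlam₁ : 0 < lam₁) {s f : StrongDual ℝ A}
    (hs : s ∈ banachSolutions y φ₁ φ₂ lam₁ lam₂) (hf : banachMeasure φ₁ f = banachMeasure φ₁ s) :
    ‖s‖ ≤ ‖f‖ := by
  have h := mem_banachSolutions.1 hs f
  rw [banachObjective, banachObjective, hf, add_le_add_iff_left] at h
  exact le_of_mul_le_mul_left h hlam₁

theorem mem_banachSolutions_of_norm_le (hlam₁ : 0 < lam₁) {s f : StrongDual ℝ A}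
    (hs : s ∈ banachSolutions y φ₁ φ₂ lam₁ lam₂) (hf : banachMeasure φ₁ f = banachMeasure φ₁ s)
    (hle : ‖f‖ ≤ ‖s‖) : f ∈ banachSolutions y φ₁ φ₂ lam₁ lam₂ := by
  refine mem_banachSolutions.2 fun g => le_trans ?_ (mem_banachSolutions.1 hs g)
  rw [banachObjective, banachObjective, hf]
  gcongr

theorem exists_sum_smul_of_mem_extremePoints_banachSolutions (hlam₁ : 0 < lam₁)
    {s : StrongDual ℝ A} (hs : s ∈ Set.extremePoints ℝ (banachSolutions y φ₁ φ₂ lam₁ lam₂)) :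
    ∃ (K : ℕ) (α : Fin K → ℝ) (e : Fin K → StrongDual ℝ A),
      K ≤ L ∧ (∀ k, α k ≠ 0) ∧ Function.Injective e ∧
      (∀ k, e k ∈ Set.extremePoints ℝ {f : StrongDual ℝ A | ‖f‖ ≤ 1}) ∧ s = ∑ k, α k • e k := by
  have h := exists_sum_smul_extremePoints_of_minimal_norm (banachMeasureLin φ₁) (s := s)
    (fun f hf => norm_le_of_mem_banachSolutions hlam₁ hs.1 hf)
    -- The least-norm solutions with the data of `s` form a subset of `V` containing `s`, so
    -- extremality passes to it.
    (inter_extremePoints_subset_extremePoints_of_subset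
      (fun f hf => mem_banachSolutions_of_norm_le hlam₁ hs.1 hf.1 hf.2) ⟨⟨rfl, le_rfl⟩, hs⟩)
  rwa [finrank_euclideanSpace_fin] at h

end Solutions

theorem mainTheorem2 {A H : Type*} [NormedAddCommGroup A] [NormedSpace ℝ A] [CompleteSpace A]
    [NormedAddCommGroup H] [InnerProductSpace ℝ H] [CompleteSpace H] (L : ℕ)
    (y : EuclideanSpace ℝ (Fin L)) (φ₁ : Fin L → A) (φ₂ : Fin L → H) (lam₁ lam₂ : ℝ)
    (hlam₁ : 0 < lam₁) (hlam₂ : 0 < lam₂) :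
    ∃ w : EuclideanSpace ℝ (Fin L),
      (banachSolutions y φ₁ φ₂ lam₁ lam₂).Nonempty ∧
      (∀ s ∈ banachSolutions y φ₁ φ₂ lam₁ lam₂, banachMeasure φ₁ s = w) ∧
      compositeSolutions y φ₁ φ₂ lam₁ lam₂ =
        banachSolutions y φ₁ φ₂ lam₁ lam₂ ×ˢ {hilbertComponent y φ₂ lam₂ w} ∧
      ∀ p ∈ Set.extremePoints ℝ (compositeSolutions y φ₁ φ₂ lam₁ lam₂),
        ∃ (K : ℕ) (α : Fin K → ℝ) (e : Fin K → StrongDual ℝ A),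
          K ≤ L ∧ (∀ k, α k ≠ 0) ∧ Function.Injective e ∧
          (∀ k, e k ∈ Set.extremePoints ℝ {f : StrongDual ℝ A | ‖f‖ ≤ 1}) ∧
          p = (∑ k, α k • e k, hilbertComponent y φ₂ lam₂ w) := by
  obtain ⟨s₀, hs₀⟩ := banachSolutions_nonempty y φ₁ φ₂ hlam₁ lam₂
  have hw : ∀ s ∈ banachSolutions y φ₁ φ₂ lam₁ lam₂,
      banachMeasure φ₁ s = banachMeasure φ₁ s₀ :=
    fun s hs => banachMeasure_eq_of_mem_banachSolutions hlam₁ hlam₂ hs hs₀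
  have hW := compositeSolutions_eq hlam₂ hw
  refine ⟨banachMeasure φ₁ s₀, ⟨s₀, hs₀⟩, hw, hW, ?_⟩
  rintro ⟨s, t⟩ hp
  rw [hW, extremePoints_prod] at hp
  obtain ⟨K, α, e, hK, hα, he, hext, rfl⟩ :=
    exists_sum_smul_of_mem_extremePoints_banachSolutions hlam₁ hp.1
  have ht : t = hilbertComponent y φ₂ lam₂ (banachMeasure φ₁ s₀) := hp.2.1
  exact ⟨K, α, e, hK, hα, he, hext, by rw [ht]⟩
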